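/- **Theorem 3.8.** Throughout, $\Lambda$ is an Artin algebra, that is, an algebra which is finitely generated as a module over a commutative Artinian ring $R$; modules are left modules, $\operatorname{mod}\Lambda$ is the category of finitely generated $\Lambda$-modules, and $\operatorname{pd}$, $\operatorname{id}$ denote projective and injective dimension. For $m\ge 1$, $\Lambda$ is an *$m$-Auslander algebra* if $\operatorname{gl.dim}\Lambda\le m+1$ and the terms $I^0(\Lambda),\dots,I^m(\Lambda)$ of the minimal injective resolution of ${}_\Lambda\Lambda$ are projective. A full subcategory $\mathscr C$ of $\operatorname{mod}\Lambda$ is *maximal $m$-orthogonal* if it is functorially finite in $\operatorname{mod}\Lambda$ (every $D\in\operatorname{mod}\Lambda$ has a morphism $D\to C$ with $C\in\mathscr C$ through which every morphism from $D$ to an object of $\mathscr C$ factors, and dually a morphism $C'\to D$ with $C'\in\mathscr C$ through which every morphism from an object of $\mathscr C$ to $D$ factors) and $$\mathscr C=\{X\in\operatorname{mod}\Lambda:\operatorname{Ext}^i_\Lambda(X,C)=0\ \forall C\in\mathscr C,\ 1\le i\le m\}=\{X\in\operatorname{mod}\Lambda:\operatorname{Ext}^i_\Lambda(C,X)=0\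 \forall C\in\mathscr C,\ 1\le i\le m\}.$$ Let $n\ge 2$, let $\Lambda$ be an $(n-1)$-Auslander algebra with $\operatorname{gl.dim}\Lambda=n$ that admits a maximal $(n-1)$-orthogonal subcategory $\mathscr C$ of $\operatorname{mod}\Lambda$, and let $S$ be a simple $\Lambda$-module with $\operatorname{pd}_\Lambda S=n-1$. Then: 1. $S$ is not injective. 2. $1\le\operatorname{id}_\Lambda S\le n-1$ if and only if $\operatorname{Hom}_\Lambda(S,P)=0$ for every indecomposable projective module $P\in\operatorname{mod}\Lambda$ with $\operatorname{id}_\Lambda P=n$. 3. $\operatorname{id}_\Lambda S=n$ if and only if $\operatorname{Hom}_\Lambda(S,P)\ne 0$ for some indecomposable projective module $P\in\operatorname{mod}\Lambda$ with $\operatorname{id}_\Lambda P=n$. -/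

import Mathlib

open CategoryTheory

universe u v

noncomputable section

namespace HigherAuslander

variable (Λ : Type v) [Ring Λ]

/-- The (left) global dimension of a ring: the supremum of the projective dimensions of all
its left modules. The projective dimension of the zero module is `⊥`. -/
def globalDimension : WithBot ℕ∞ :=
  ⨆ M : ModuleCat.{v} Λ, projectiveDimension M

/-- `mod Λ`: the finitely generated left `Λ`-modules, as a full subcategory of all modules. -/
def finitelyGenerated : ObjectProperty (ModuleCat.{v} Λ) :=
  fun M => Module.Finite Λ M

variable {Λ}

/-- An injective resolution `0 ⟶ M ⟶ I⁰ ⟶ I¹ ⟶ ⋯` is minimal if, for every `i`, the kernel of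
`Iⁱ ⟶ Iⁱ⁺¹` is an essential submodule of `Iⁱ`, i.e. it meets every nonzero submodule
nontrivially. As that kernel is the image of `M` for `i = 0` and the image of `Iⁱ⁻¹` for `i > 0`,
this says that each `Iⁱ` is the injective envelope of the corresponding cosyzygy. -/
def IsMinimalResolution {M : ModuleCat.{v} Λ} (I : InjectiveResolution M) : Prop :=
  ∀ (i : ℕ) (N : Submodule Λ (I.cocomplex.X i)),
    N ⊓ LinearMap.ker (I.cocomplex.d i (i + 1)).hom = ⊥ → N = ⊥

variable (Λ) in
/-- The homological condition defining `n`-Auslander algebras: `gl.dim Λ ≤ n + 1` and the terms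
`I⁰(Λ), …, Iⁿ(Λ)` of the minimal injective resolution of the left module `Λ` are projective.
The minimal injective resolution is unique up to isomorphism, so it does not matter which
one is taken. -/
def IsAuslander (n : ℕ) : Prop :=
  globalDimension Λ ≤ ((n + 1 : ℕ) : WithBot ℕ∞) ∧
    ∃ I : InjectiveResolution (ModuleCat.of Λ Λ), IsMinimalResolution I ∧
      ∀ i ≤ n, Projective (I.cocomplex.X i)

/-- A morphism `f : D ⟶ C` with `C` in `𝒞` is a left `𝒞`-approximation of `D` if every morphism
from `D` to an object of `𝒞` factors through `f`. -/
def IsLeftApproximation (𝒞 : ObjectProperty (ModuleCat.{v} Λ)) {D C : ModuleCat.{v} Λ}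
    (f : D ⟶ C) : Prop :=
  𝒞 C ∧ ∀ (C' : ModuleCat.{v} Λ), 𝒞 C' → ∀ g : D ⟶ C', ∃ h : C ⟶ C', f ≫ h = g

/-- A morphism `f : C ⟶ D` with `C` in `𝒞` is a right `𝒞`-approximation of `D` if every morphism
from an object of `𝒞` to `D` factors through `f`. -/
def IsRightApproximation (𝒞 : ObjectProperty (ModuleCat.{v} Λ)) {C D : ModuleCat.{v} Λ}
    (f : C ⟶ D) : Prop :=
  𝒞 C ∧ ∀ (C' : ModuleCat.{v} Λ), 𝒞 C' → ∀ g : C' ⟶ D, ∃ h : C' ⟶ C, h ≫ f = g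

/-- `𝒞` is functorially finite in `𝒟`: every object of `𝒟` has a left and a right
`𝒞`-approximation. -/
def IsFunctoriallyFinite (𝒞 𝒟 : ObjectProperty (ModuleCat.{v} Λ)) : Prop :=
  ∀ D : ModuleCat.{v} Λ, 𝒟 D →
    (∃ (C : ModuleCat.{v} Λ) (f : D ⟶ C), IsLeftApproximation 𝒞 f) ∧
    (∃ (C : ModuleCat.{v} Λ) (f : C ⟶ D), IsRightApproximation 𝒞 f)

/-- The finitely generated `X` with `Extⁱ(X, C) = 0` for all `C` in `𝒞` and `1 ≤ i ≤ n`. -/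
def leftPerp (n : ℕ) (𝒞 : ObjectProperty (ModuleCat.{v} Λ)) : ObjectProperty (ModuleCat.{v} Λ) :=
  fun X => finitelyGenerated Λ X ∧
    ∀ C : ModuleCat.{v} Λ, 𝒞 C → ∀ i : ℕ, 1 ≤ i → i ≤ n → Subsingleton (Abelian.Ext X C i)

/-- The finitely generated `X` with `Extⁱ(C, X) = 0` for all `C` in `𝒞` and `1 ≤ i ≤ n`. -/
def rightPerp (n : ℕ) (𝒞 : ObjectProperty (ModuleCat.{v} Λ)) : ObjectProperty (ModuleCat.{v} Λ) :=
  fun X => finitelyGenerated Λ X ∧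
    ∀ C : ModuleCat.{v} Λ, 𝒞 C → ∀ i : ℕ, 1 ≤ i → i ≤ n → Subsingleton (Abelian.Ext C X i)

/-- `𝒞` is a maximal `n`-orthogonal subcategory of `𝒟`, where `𝒟` consists of finitely generated
modules. -/
structure IsMaximalOrthogonal (n : ℕ) (𝒞 𝒟 : ObjectProperty (ModuleCat.{v} Λ)) : Prop where
  le : 𝒞 ≤ 𝒟
  functoriallyFinite : IsFunctoriallyFinite 𝒞 𝒟
  eq_leftPerp : 𝒞 = leftPerp n 𝒞 ⊓ 𝒟
  eq_rightPerp : 𝒞 = rightPerp n 𝒞 ⊓ 𝒟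

end HigherAuslander

end

/-! Write `n = m + 1`. Projectives and injectives lie in `𝒞`, so `Extⁱ(E, P) = 0` for `1 ≤ i ≤ m`,
`E` injective and `P` projective (all finitely generated). Since `pd S = m`, `Extᵐ(S, Λ) ≠ 0`, so
`S` is not injective. All modules have `id ≤ m + 1`, so parts 2 and 3 both reduce to: `id S ≤ m` iff
`S` maps trivially to every indecomposable projective `P` with `id P = m + 1`.

Suppose `id S ≤ m` and embed `S` in an injective `E`. Dimension shifting gives `Ext¹(E/S, P) = 0`,
so any `S ⟶ P` extends to `E`. If it is nonzero, Fitting's lemma makes `P` a summand of `E`, hence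
injective, a contradiction (`eq_zero_of_hasInjectiveDimensionLE`).

Conversely, `Extᵐ(S, Λ) ≠ 0` embeds `S` in a projective-injective `Q`. Every object of `𝒞` is a
projective plus a module with no maps to projectives (`exists_projective_quotient`), so the
hypothesis makes `S ⟶ Q` a left `𝒞`-approximation (`exists_extension`) and `Ext¹(Q/S, 𝒞) = 0`.
Iterated approximations turn this into `Extᵐ(𝒞, Q/S) = 0` (`subsingleton_ext_of_forall`), whence
`Extᵐ⁺¹(E, S) = 0` for injective `E` and `id S ≤ m`. -/

section

open Limits

namespace HigherAuslander

/-! ### Vanishing of Ext along short exact sequences -/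

section ExtVanishing

open Abelian

universe w' v' u'

variable {C : Type u'} [Category.{v'} C] [Abelian C] [HasExt.{w'} C] {S : ShortComplex C}

lemma subsingleton_ext_zero_iff {X Y : C} : Subsingleton (Ext X Y 0) ↔ ∀ f : X ⟶ Y, f = 0 :=
  ⟨fun _ _ => Ext.homEquiv₀.symm.injective (Subsingleton.elim _ _),
    fun h => ⟨fun _ _ => Ext.homEquiv₀.injective ((h _).trans (h _).symm)⟩⟩

lemma subsingleton_ext_left_of_X₂_of_X₁ (hS : S.ShortExact) (X : C) {n : ℕ}
    (h₂ : Subsingleton (Ext X S.X₂ n)) (h₁ : Subsingleton (Ext X S.X₁ (n + 1))) :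
    Subsingleton (Ext X S.X₃ n) := by
  refine subsingleton_of_forall_eq 0 fun x => ?_
  obtain ⟨y, rfl⟩ := Ext.covariant_sequence_exact₃ X hS x rfl (Subsingleton.elim _ _)
  rw [Subsingleton.elim y 0, Ext.zero_comp]

lemma subsingleton_ext_left_of_X₃_of_X₂ (hS : S.ShortExact) (X : C) {n : ℕ}
    (h₃ : Subsingleton (Ext X S.X₃ n)) (h₂ : Subsingleton (Ext X S.X₂ (n + 1))) :
    Subsingleton (Ext X S.X₁ (n + 1)) := by
  refine subsingleton_of_forall_eq 0 fun x => ?_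
  obtain ⟨y, rfl⟩ := Ext.covariant_sequence_exact₁ X hS x (Subsingleton.elim _ _) rfl
  rw [Subsingleton.elim y 0, Ext.zero_comp]

lemma subsingleton_ext_right_of_X₂_of_X₃ (hS : S.ShortExact) (Y : C) {n : ℕ}
    (h₂ : Subsingleton (Ext S.X₂ Y n)) (h₃ : Subsingleton (Ext S.X₃ Y (n + 1))) :
    Subsingleton (Ext S.X₁ Y n) := by
  refine subsingleton_of_forall_eq 0 fun x => ?_
  obtain ⟨y, rfl⟩ := Ext.contravariant_sequence_exact₁ hS Y x (add_comm 1 n)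
    (Subsingleton.elim _ _)
  rw [Subsingleton.elim y 0, Ext.comp_zero]

lemma subsingleton_ext_right_of_X₁_of_X₂ (hS : S.ShortExact) (Y : C) {n : ℕ}
    (h₁ : Subsingleton (Ext S.X₁ Y n)) (h₂ : Subsingleton (Ext S.X₂ Y (n + 1))) :
    Subsingleton (Ext S.X₃ Y (n + 1)) := by
  refine subsingleton_of_forall_eq 0 fun x => ?_
  obtain ⟨y, rfl⟩ := Ext.contravariant_sequence_exact₃ hS Y x (Subsingleton.elim _ _)
    (add_comm 1 n)
  rw [Subsingleton.elim y 0, Ext.comp_zero]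

/-- If every morphism `X₁ ⟶ Y` extends to `X₂` and `Ext¹(X₂, Y) = 0`, then `Ext¹(X₃, Y) = 0`. -/
lemma subsingleton_ext_one_of_extension (hS : S.ShortExact) (Y : C)
    (h : ∀ f : S.X₁ ⟶ Y, ∃ g : S.X₂ ⟶ Y, S.f ≫ g = f) (h₂ : Subsingleton (Ext S.X₂ Y 1)) :
    Subsingleton (Ext S.X₃ Y 1) := by
  refine subsingleton_of_forall_eq 0 fun x => ?_
  obtain ⟨y, rfl⟩ := Ext.contravariant_sequence_exact₃ hS Y x (Subsingleton.elim _ _)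
    (add_comm 1 0)
  obtain ⟨f, rfl⟩ := Ext.homEquiv₀.symm.surjective y
  obtain ⟨g, rfl⟩ := h f
  simp [← Ext.mk₀_comp_mk₀]

/-- If no nonzero morphism `X₁ ⟶ Y` extends to `X₂` and `Ext¹(X₃, Y) = 0`, then
`Hom(X₁, Y) = 0`. -/
lemma eq_zero_of_no_extension (hS : S.ShortExact) (Y : C)
    (h : ∀ g : S.X₂ ⟶ Y, S.f ≫ g = 0) (h₃ : Subsingleton (Ext S.X₃ Y 1)) (f : S.X₁ ⟶ Y) :
    f = 0 := by
  obtain ⟨y, hy⟩ := Ext.contravariant_sequence_exact₁ hS Y (Ext.mk₀ f) (add_comm 1 0)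
    (Subsingleton.elim _ _)
  obtain ⟨g, rfl⟩ := Ext.homEquiv₀.symm.surjective y
  apply Ext.homEquiv₀.symm.injective
  simp only [Ext.homEquiv₀_symm_apply, Ext.mk₀_comp_mk₀, h, Ext.mk₀_zero] at hy ⊢
  exact hy.symm

lemma exists_section_of_subsingleton_ext_one (hS : S.ShortExact)
    (h : Subsingleton (Ext S.X₃ S.X₁ 1)) : ∃ s : S.X₃ ⟶ S.X₂, s ≫ S.g = 𝟙 _ := by
  obtain ⟨y, hy⟩ := Ext.covariant_sequence_exact₃ S.X₃ hS (Ext.mk₀ (𝟙 _)) (zero_add 1)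
    (Subsingleton.elim _ _)
  obtain ⟨g, rfl⟩ := Ext.homEquiv₀.symm.surjective y
  exact ⟨g, Ext.homEquiv₀.symm.injective (by simpa using hy)⟩

lemma exists_retraction_of_subsingleton_ext_one (hS : S.ShortExact)
    (h : Subsingleton (Ext S.X₃ S.X₁ 1)) : ∃ r : S.X₂ ⟶ S.X₁, S.f ≫ r = 𝟙 _ := by
  obtain ⟨y, hy⟩ := Ext.contravariant_sequence_exact₁ hS S.X₁ (Ext.mk₀ (𝟙 _)) (add_comm 1 0)
    (Subsingleton.elim _ _)
  obtain ⟨g, rfl⟩ := Ext.homEquiv₀.symm.surjective y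
  exact ⟨g, Ext.homEquiv₀.symm.injective (by simpa using hy)⟩

lemma projective_X₃_of_subsingleton_ext_one (hS : S.ShortExact) [Projective S.X₂]
    (h : Subsingleton (Ext S.X₃ S.X₁ 1)) : Projective S.X₃ := by
  obtain ⟨s, hs⟩ := exists_section_of_subsingleton_ext_one hS h
  exact Retract.projective ⟨s, S.g, hs⟩

lemma injective_X₁_of_subsingleton_ext_one (hS : S.ShortExact) [Injective S.X₂]
    (h : Subsingleton (Ext S.X₃ S.X₁ 1)) : Injective S.X₁ := by
  obtain ⟨r, hr⟩ := exists_retraction_of_subsingleton_ext_one hS h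
  exact Retract.injective ⟨S.f, r, hr⟩

lemma subsingleton_ext_of_retract_right {X Y Z : C} (r : Retract Y Z) {n : ℕ}
    (h : Subsingleton (Ext X Z n)) : Subsingleton (Ext X Y n) := by
  refine subsingleton_of_forall_eq 0 fun x => ?_
  rw [← x.comp_mk₀_id, ← r.retract, ← Ext.mk₀_comp_mk₀, ← Ext.comp_assoc_of_second_deg_zero,
    Subsingleton.elim (x.comp (Ext.mk₀ r.i) (add_zero n)) 0, Ext.zero_comp]

end ExtVanishing

/-! ### Finitely generated modules, projective dimension and finiteness -/

section Modules

lemma shortExact_kernel {C : Type*} [Category* C] [Abelian C] {X Y : C} (f : X ⟶ Y) [Epi f] :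
    (ShortComplex.mk _ _ (kernel.condition f)).ShortExact where
  exact := ShortComplex.exact_kernel f

lemma shortExact_cokernel {C : Type*} [Category* C] [Abelian C] {X Y : C} (f : X ⟶ Y) [Mono f] :
    (ShortComplex.mk _ _ (cokernel.condition f)).ShortExact where
  exact := ShortComplex.exact_cokernel f

variable {Λ : Type v} [Ring Λ]

lemma finite_of_epi {M N : ModuleCat.{v} Λ} (f : M ⟶ N) [Epi f] [Module.Finite Λ M] :
    Module.Finite Λ N :=
  Module.Finite.of_surjective f.hom ((ModuleCat.epi_iff_surjective f).1 inferInstance)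

lemma finite_of_mono [IsNoetherianRing Λ] {M N : ModuleCat.{v} Λ} (f : M ⟶ N) [Mono f]
    [Module.Finite Λ N] : Module.Finite Λ M :=
  Module.Finite.of_injective f.hom ((ModuleCat.mono_iff_injective f).1 inferInstance)

instance finite_kernel [IsNoetherianRing Λ] {M N : ModuleCat.{v} Λ} (f : M ⟶ N)
    [Module.Finite Λ M] : Module.Finite Λ (kernel f : ModuleCat.{v} Λ) :=
  finite_of_mono (kernel.ι f)

instance finite_cokernel {M N : ModuleCat.{v} Λ} (f : M ⟶ N) [Module.Finite Λ N] :
    Module.Finite Λ (cokernel f : ModuleCat.{v} Λ) :=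
  finite_of_epi (cokernel.π f)

instance finite_biprod (M N : ModuleCat.{v} Λ) [Module.Finite Λ M] [Module.Finite Λ N] :
    Module.Finite Λ (M ⊞ N : ModuleCat.{v} Λ) :=
  Module.Finite.equiv (ModuleCat.biprodIsoProd M N).toLinearEquiv.symm

/-- A finitely generated module is a quotient of a finitely generated free module. -/
lemma exists_epi_from_free (M : ModuleCat.{v} Λ) [Module.Finite Λ M] :
    ∃ (m : ℕ) (f : ModuleCat.of Λ (Fin m → Λ) ⟶ M), Epi f := by
  obtain ⟨m, f, hf⟩ := Module.Finite.exists_fin' Λ M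
  exact ⟨m, ModuleCat.ofHom f, (ModuleCat.epi_iff_surjective _).2 hf⟩

instance projective_free (m : ℕ) : Projective (ModuleCat.of Λ (Fin m → Λ)) :=
  (IsProjective.iff_projective _).1 inferInstance

instance projective_self : Projective (ModuleCat.of Λ Λ) :=
  (IsProjective.iff_projective _).1 inferInstance

lemma subsingleton_ext_free {X : ModuleCat.{v} Λ} {n : ℕ}
    (h : Subsingleton (Abelian.Ext X (ModuleCat.of Λ Λ) n)) (m : ℕ) :
    Subsingleton (Abelian.Ext X (ModuleCat.of Λ (Fin m → Λ)) n) := by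
  induction m with
  | zero =>
    refine subsingleton_of_forall_eq 0 fun x => ?_
    have hz : IsZero (ModuleCat.of Λ (Fin 0 → Λ)) := ModuleCat.isZero_of_subsingleton _
    rw [← x.comp_mk₀_id, hz.eq_zero_of_tgt (𝟙 _), Abelian.Ext.mk₀_zero, Abelian.Ext.comp_zero]
  | succ m ih =>
    let e : ModuleCat.of Λ (Fin (m + 1) → Λ) ≅ ModuleCat.of Λ Λ ⊞ ModuleCat.of Λ (Fin m → Λ) :=
      (Fin.consLinearEquiv Λ fun _ => Λ).symm.toModuleIso ≪≫
        (ModuleCat.biprodIsoProd (ModuleCat.of Λ Λ) (ModuleCat.of Λ (Fin m → Λ))).symm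
    refine subsingleton_ext_of_retract_right e.retract ?_
    have : Subsingleton (Abelian.Ext X (ModuleCat.of Λ Λ) n ×
      Abelian.Ext X (ModuleCat.of Λ (Fin m → Λ)) n) := inferInstance
    exact Abelian.Ext.addEquivBiprod.subsingleton

lemma retract_of_projective (P : ModuleCat.{v} Λ) [Module.Finite Λ P] [Projective P] :
    ∃ m, Nonempty (Retract P (ModuleCat.of Λ (Fin m → Λ))) := by
  obtain ⟨m, f, _⟩ := exists_epi_from_free P
  exact ⟨m, ⟨⟨Projective.factorThru (𝟙 P) f, f, by simp⟩⟩⟩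

lemma subsingleton_ext_projective {X : ModuleCat.{v} Λ} {n : ℕ}
    (h : Subsingleton (Abelian.Ext X (ModuleCat.of Λ Λ) n)) (P : ModuleCat.{v} Λ)
    [Module.Finite Λ P] [Projective P] : Subsingleton (Abelian.Ext X P n) := by
  obtain ⟨m, ⟨r⟩⟩ := retract_of_projective P
  exact subsingleton_ext_of_retract_right r (subsingleton_ext_free h m)

/-- The projective dimension of a finitely generated module `M` with `pd M ≤ k + 1` and
`Extᵏ⁺¹(M, Λ) = 0` is at most `k`. -/
lemma hasProjectiveDimensionLE_of_subsingleton_ext [IsNoetherianRing Λ] (k : ℕ)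
    (M : ModuleCat.{v} Λ) [Module.Finite Λ M] (hM : HasProjectiveDimensionLE M (k + 1))
    (h : Subsingleton (Abelian.Ext M (ModuleCat.of Λ Λ) (k + 1))) :
    HasProjectiveDimensionLE M k := by
  induction k generalizing M with
  | zero =>
    obtain ⟨m, f, _⟩ := exists_epi_from_free M
    obtain ⟨m', f', _⟩ := exists_epi_from_free (kernel f)
    -- As `pd M ≤ 1`, `Ext¹(M, -)` is right exact, so it vanishes on the quotient `kernel f` of a
    -- free module and the presentation of `M` splits.
    have : Subsingleton (Abelian.Ext M (kernel f) 1) :=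
      subsingleton_ext_left_of_X₂_of_X₁ (shortExact_kernel f') M (subsingleton_ext_free h _)
        (hM.subsingleton _ _ _ le_rfl _)
    have : Projective M := projective_X₃_of_subsingleton_ext_one (shortExact_kernel f) this
    exact projective_iff_hasProjectiveDimensionLE_zero M |>.1 this
  | succ k ih =>
    obtain ⟨m, f, _⟩ := exists_epi_from_free M
    have hS := shortExact_kernel f
    refine (hS.hasProjectiveDimensionLT_X₃_iff k (projective_free m)).2 ?_
    refine ih _ ((hS.hasProjectiveDimensionLT_X₃_iff (k + 1) (projective_free m)).1 hM) ?_
    exact subsingleton_ext_right_of_X₂_of_X₃ hS _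
      (HasProjectiveDimensionLT.subsingleton _ 1 _ (by simp) _) h

lemma projective_of_subsingleton_ext [IsNoetherianRing Λ] (k : ℕ)
    (M : ModuleCat.{v} Λ) [Module.Finite Λ M] (hM : HasProjectiveDimensionLE M k)
    (h : ∀ i, 1 ≤ i → i ≤ k → Subsingleton (Abelian.Ext M (ModuleCat.of Λ Λ) i)) :
    Projective M := by
  induction k with
  | zero => exact (projective_iff_hasProjectiveDimensionLE_zero M).2 hM
  | succ k ih =>
    exact ih (hasProjectiveDimensionLE_of_subsingleton_ext k M hM (h _ (by simp) le_rfl))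
      fun i h1 h2 => h i h1 (by lia)

/-- For a class `𝓔` closed under biproducts, some morphism from an artinian module `M` to a module
in `𝓔` has the least kernel among all of them. -/
lemma exists_least_kernel (𝓔 : ObjectProperty (ModuleCat.{v} Λ)) (h0 : ∃ E, 𝓔 E)
    (hsum : ∀ X Y, 𝓔 X → 𝓔 Y → 𝓔 (X ⊞ Y)) (M : ModuleCat.{v} Λ) [IsArtinian Λ M] :
    ∃ (E : ModuleCat.{v} Λ) (φ : M ⟶ E), 𝓔 E ∧
      ∀ (E' : ModuleCat.{v} Λ) (ψ : M ⟶ E'), 𝓔 E' →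
        LinearMap.ker φ.hom ≤ LinearMap.ker ψ.hom := by
  obtain ⟨E₀, hE₀⟩ := h0
  obtain ⟨_, ⟨E, φ, hE, rfl⟩, hmin⟩ := IsArtinian.set_has_minimal
    {N : Submodule Λ M | ∃ (E : ModuleCat.{v} Λ) (φ : M ⟶ E), 𝓔 E ∧ LinearMap.ker φ.hom = N}
    ⟨_, E₀, 0, hE₀, rfl⟩
  refine ⟨E, φ, hE, fun E' ψ hE' => ?_⟩
  -- The joint map into `E ⊞ E'` has kernel `ker φ ⊓ ker ψ`; minimality of `ker φ` forces this to be
  -- all of `ker φ`.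
  have h1 : LinearMap.ker (biprod.lift φ ψ).hom ≤ LinearMap.ker φ.hom := fun x hx => by
    have : φ.hom x = (biprod.fst : E ⊞ E' ⟶ E).hom ((biprod.lift φ ψ).hom x) := by
      rw [← LinearMap.comp_apply, ← ModuleCat.hom_comp, biprod.lift_fst]
    rw [LinearMap.mem_ker] at hx ⊢
    rw [this, hx, map_zero]
  have h2 : LinearMap.ker (biprod.lift φ ψ).hom ≤ LinearMap.ker ψ.hom := fun x hx => by
    have : ψ.hom x = (biprod.snd : E ⊞ E' ⟶ E').hom ((biprod.lift φ ψ).hom x) := by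
      rw [← LinearMap.comp_apply, ← ModuleCat.hom_comp, biprod.lift_snd]
    rw [LinearMap.mem_ker] at hx ⊢
    rw [this, hx, map_zero]
  rcases h1.lt_or_eq with h | h
  · exact absurd h (hmin _ ⟨_, biprod.lift φ ψ, hsum _ _ hE hE', rfl⟩)
  · exact h ▸ h2

/-- A projective module with a finitely generated essential submodule is finitely generated. -/
lemma finite_of_essential [IsNoetherianRing Λ] {I : Type v} [AddCommGroup I] [Module Λ I]
    [Module.Projective Λ I] (N : Submodule Λ I) (hN : N.FG)
    (hess : ∀ N' : Submodule Λ I, N' ⊓ N = ⊥ → N' = ⊥) : Module.Finite Λ I := by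
  obtain ⟨s, hs⟩ := Module.projective_def.1 (inferInstance : Module.Projective Λ I)
  obtain ⟨G, rfl⟩ := hN
  classical
  -- `T` collects the finitely many coordinates that are nonzero on generators of `N`. Projection to
  -- them is injective on `N`, hence on `I` by essentiality.
  let T : Finset I := G.biUnion fun g => (s g).support
  let r : I →ₗ[Λ] (T → Λ) := LinearMap.pi fun t => Finsupp.lapply t.1 ∘ₗ s
  have hle : Submodule.span Λ (G : Set I) ≤ (Finsupp.supported Λ Λ (T : Set I)).comap s := by
    rw [Submodule.span_le]
    intro g hg t ht
    exact Finset.mem_coe.2 (Finset.mem_biUnion.2 ⟨g, hg, ht⟩)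
  have hr : LinearMap.ker r = ⊥ := by
    refine hess _ ((Submodule.eq_bot_iff _).2 fun x hx => ?_)
    have h0 : s x = 0 := by
      ext t
      by_cases ht : t ∈ T
      · exact congr_fun (LinearMap.mem_ker.1 hx.1) ⟨t, ht⟩
      · by_contra h
        exact ht (hle hx.2 (Finsupp.mem_support_iff.2 h))
    rw [← hs x, h0, map_zero]
  exact Module.Finite.of_injective r (LinearMap.ker_eq_bot.1 hr)

end Modules

/-! ### Projective-injective coresolutions and enough finitely generated injectives -/

section

variable {Λ : Type v} [Ring Λ]

/-- `M` is finitely generated and admits an exact sequence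
`0 ⟶ M ⟶ E⁰ ⟶ ⋯ ⟶ Eᵏ⁻¹` of finitely generated modules with every `Eⁱ` projective and
injective. -/
def HasProjInjCoresolution : ℕ → ModuleCat.{v} Λ → Prop
  | 0, M => Module.Finite Λ M
  | k + 1, M => Module.Finite Λ M ∧ ∃ (E Z : ModuleCat.{v} Λ) (f : M ⟶ E) (g : E ⟶ Z)
      (w : f ≫ g = 0), (ShortComplex.mk f g w).ShortExact ∧ Module.Finite Λ E ∧ Projective E ∧
        Injective E ∧ HasProjInjCoresolution k Z

lemma HasProjInjCoresolution.of_iso {k : ℕ} {M N : ModuleCat.{v} Λ} (e : M ≅ N)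
    (h : HasProjInjCoresolution k M) : HasProjInjCoresolution k N := by
  cases k with
  | zero =>
    have : Module.Finite Λ M := h
    exact finite_of_epi e.hom
  | succ k =>
    obtain ⟨_, E, Z, f, g, w, hS, hE⟩ := h
    refine ⟨finite_of_epi e.hom, E, Z, e.inv ≫ f, g, by simp [w], ?_, hE⟩
    exact ShortComplex.shortExact_of_iso
      (ShortComplex.isoMk (S₁ := .mk f g w) e (Iso.refl _) (Iso.refl _) (by simp) (by simp)) hS

/-- Dimension shifting reduces `Extⁱ(K, M)` to the maps from `K` to the `i`-th cosyzygy, which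
embeds in a projective term. -/
lemma HasProjInjCoresolution.subsingleton_ext {k : ℕ} {M K : ModuleCat.{v} Λ}
    (hM : HasProjInjCoresolution k M)
    (hK : ∀ P : ModuleCat.{v} Λ, Module.Finite Λ P → Projective P → ∀ f : K ⟶ P, f = 0)
    {i : ℕ} (hi : i < k) : Subsingleton (Abelian.Ext K M i) := by
  induction k generalizing M i with
  | zero => simp at hi
  | succ k ih =>
    obtain ⟨_, E, Z, f, g, w, hS, hE, hE', _, hZ⟩ := hM
    cases i with
    | zero =>
      have : Mono f := hS.mono_f
      exact subsingleton_ext_zero_iff.2 fun a => (cancel_mono f).1 (by simp [hK E hE hE'])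
    | succ i =>
      exact subsingleton_ext_left_of_X₃_of_X₂ hS K (ih hZ (by lia))
        (HasInjectiveDimensionLT.subsingleton _ 1 _ (by simp) _)

/-- A nonzero `Extᵏ(T, M)` is witnessed by a nonzero morphism from `T` to a term of the injective
coresolution of `M`. -/
lemma HasProjInjCoresolution.exists_hom_ne_zero {n k : ℕ} {M T : ModuleCat.{v} Λ}
    (hM : HasProjInjCoresolution n M) (hid : HasInjectiveDimensionLE M n) (hk : k ≤ n)
    (hT : ¬ Subsingleton (Abelian.Ext T M k)) :
    ∃ (E : ModuleCat.{v} Λ) (f : T ⟶ E), Module.Finite Λ E ∧ Injective E ∧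
      (k < n → Projective E) ∧ f ≠ 0 := by
  induction n generalizing M k with
  | zero =>
    -- The last cosyzygy is itself the injective term sought here; it need not be projective, hence
    -- the proviso `k < n`.
    obtain rfl : k = 0 := by lia
    rw [subsingleton_ext_zero_iff] at hT
    push Not at hT
    obtain ⟨f, hf⟩ := hT
    exact ⟨M, f, hM, injective_iff_hasInjectiveDimensionLT_one.2 hid, by simp, hf⟩
  | succ n ih =>
    obtain ⟨_, E, Z, f, g, w, hS, hE, hE', hE'', hZ⟩ := hM
    cases k with
    | zero =>
      rw [subsingleton_ext_zero_iff] at hT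
      push Not at hT
      obtain ⟨a, ha⟩ := hT
      have : Mono f := hS.mono_f
      exact ⟨E, a ≫ f, hE, hE'', fun _ => hE', fun h => ha ((cancel_mono f).1 (by simpa using h))⟩
    | succ k =>
      have hT' : ¬ Subsingleton (Abelian.Ext T Z k) := fun h =>
        hT (subsingleton_ext_left_of_X₃_of_X₂ hS T h
          (HasInjectiveDimensionLT.subsingleton _ 1 _ (by simp) _))
      obtain ⟨E', f', h1, h2, h3, h4⟩ :=
        ih hZ ((hS.hasInjectiveDimensionLT_X₃_iff n hE'').2 hid) (by lia) hT'
      exact ⟨E', f', h1, h2, fun h => h3 (by lia), h4⟩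

/-- The cosyzygy sequences of an injective resolution. -/
lemma shortExact_cosyzygy {M : ModuleCat.{v} Λ} (I : InjectiveResolution M) (i : ℕ) :
    (ShortComplex.mk (kernel.ι (I.cocomplex.d i (i + 1)))
      (kernel.lift (I.cocomplex.d (i + 1) (i + 2)) (I.cocomplex.d i (i + 1)) (by simp))
      (by simp [← cancel_mono (kernel.ι _)])).ShortExact := by
  have hepi := (I.exact_succ i).epi_kernelLift
  refine ⟨?_⟩
  -- The sequence differs from the kernel sequence of `d` only by a monomorphism on the third term,
  -- which preserves exactness in the middle.
  let S₂ := ShortComplex.mk _ _ (kernel.condition (I.cocomplex.d i (i + 1)))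
  let φ : ShortComplex.mk (kernel.ι (I.cocomplex.d i (i + 1)))
      (kernel.lift (I.cocomplex.d (i + 1) (i + 2)) (I.cocomplex.d i (i + 1)) (by simp))
      (by simp [← cancel_mono (kernel.ι _)]) ⟶ S₂ :=
    { τ₁ := 𝟙 _, τ₂ := 𝟙 _, τ₃ := kernel.ι _ }
  have : Epi φ.τ₁ := inferInstanceAs (Epi (𝟙 _))
  have : IsIso φ.τ₂ := inferInstanceAs (IsIso (𝟙 _))
  have : Mono φ.τ₃ := inferInstanceAs (Mono (kernel.ι _))
  exact (ShortComplex.exact_iff_of_epi_of_isIso_of_mono φ).2 (ShortComplex.exact_kernel _)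

lemma IsMinimalResolution.finite_X [IsNoetherianRing Λ] {M : ModuleCat.{v} Λ}
    {I : InjectiveResolution M} (hI : IsMinimalResolution I) (i : ℕ)
    [Projective (I.cocomplex.X i)]
    (h : Module.Finite Λ (kernel (I.cocomplex.d i (i + 1)) : ModuleCat.{v} Λ)) :
    Module.Finite Λ (I.cocomplex.X i) := by
  have : Module.Finite Λ (LinearMap.ker (I.cocomplex.d i (i + 1)).hom) :=
    Module.Finite.equiv (ModuleCat.kernelIsoKer (I.cocomplex.d i (i + 1))).toLinearEquiv
  exact finite_of_essential _ (Module.Finite.iff_fg.1 this) (hI i)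

/-- Finite generation climbs the minimal resolution: a projective term with finitely generated
essential kernel is finitely generated, hence so is its image, the next kernel. -/
lemma IsAuslander.hasProjInjCoresolution [IsNoetherianRing Λ] {n : ℕ} (h : IsAuslander Λ n) :
    HasProjInjCoresolution (n + 1) (ModuleCat.of Λ Λ) := by
  obtain ⟨-, I, hI, hproj⟩ := h
  let e : (kernel (I.cocomplex.d 0 1) : ModuleCat.{v} Λ) ≅ ModuleCat.of Λ Λ :=
    (kernelIsKernel _).conePointUniqueUpToIso I.isLimitKernelFork
  have hfin : ∀ i ≤ n + 1,
      Module.Finite Λ (kernel (I.cocomplex.d i (i + 1)) : ModuleCat.{v} Λ) := by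
    intro i hi
    induction i with
    | zero => exact finite_of_epi e.inv
    | succ i ih =>
      have := hproj i (by lia)
      have := hI.finite_X i (ih (by lia))
      have := (shortExact_cosyzygy I i).epi_g
      exact finite_of_epi (kernel.lift (I.cocomplex.d (i + 1) (i + 2))
        (I.cocomplex.d i (i + 1)) (I.complex_d_comp i))
  have hall : ∀ k i, i + k = n + 1 →
      HasProjInjCoresolution k (kernel (I.cocomplex.d i (i + 1)) : ModuleCat.{v} Λ) := by
    intro k
    induction k with
    | zero => exact fun i hi => hfin i (by lia)
    | succ k ih =>
      intro i hi
      have := hproj i (by lia)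
      exact ⟨hfin i (by lia), _, _, _, _, _, shortExact_cosyzygy I i,
        hI.finite_X i (hfin i (by lia)), this, I.injective i, ih (i + 1) (by lia)⟩
  exact (hall (n + 1) 0 (by simp)).of_iso e

/-- Over a ring all of whose modules have projective dimension at most `n`, a finitely generated
nonzero module `T` has `Extᵏ(T, Λ) ≠ 0` for some `k ≤ n`. -/
lemma exists_ext_ne_zero [IsNoetherianRing Λ] {n : ℕ} (T : ModuleCat.{v} Λ) [Module.Finite Λ T]
    (hgd : HasProjectiveDimensionLE T n) (hT : ¬ IsZero T) :
    ∃ k ≤ n, ¬ Subsingleton (Abelian.Ext T (ModuleCat.of Λ Λ) k) := by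
  by_contra! h
  have := projective_of_subsingleton_ext n T hgd fun i _ hi => h i hi
  exact hT ((IsZero.iff_id_eq_zero T).2
    (subsingleton_ext_zero_iff.1 (subsingleton_ext_projective (h 0 (by simp)) T) _))

variable (Λ) in
/-- Every finitely generated module embeds in a finitely generated injective module. -/
def HasEnoughFiniteInjectives : Prop :=
  ∀ (M : ModuleCat.{v} Λ) [Module.Finite Λ M],
    ∃ (E : ModuleCat.{v} Λ) (f : M ⟶ E), Module.Finite Λ E ∧ Injective E ∧ Mono f

/-- No duality is needed: a simple submodule of the least kernel has some nonzero `Extᵏ` into `Λ`,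
hence a nonzero map to a finitely generated injective. Extended to `M`, that map would have to kill
the simple submodule. -/
lemma hasEnoughFiniteInjectives [IsArtinianRing Λ] {n : ℕ}
    (hdom : HasProjInjCoresolution n (ModuleCat.of Λ Λ))
    (hgd : ∀ M : ModuleCat.{v} Λ, HasProjectiveDimensionLE M n)
    (hid : HasInjectiveDimensionLE (ModuleCat.of Λ Λ) n) : HasEnoughFiniteInjectives Λ := by
  intro M _
  obtain ⟨E, φ, ⟨hE, hE'⟩, hφ⟩ := exists_least_kernel
    (fun E : ModuleCat.{v} Λ => Module.Finite Λ E ∧ Injective E)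
    ⟨ModuleCat.of Λ PUnit, inferInstance,
      (ModuleCat.isZero_of_subsingleton (ModuleCat.of Λ PUnit)).injective⟩
    (fun X Y ⟨_, _⟩ ⟨_, _⟩ => ⟨inferInstance, inferInstance⟩) M
  refine ⟨E, φ, hE, hE', (ModuleCat.mono_iff_injective φ).2 (LinearMap.ker_eq_bot.1 ?_)⟩
  by_contra hne
  obtain ⟨N, hN, hle⟩ := (eq_bot_or_exists_atom_le (LinearMap.ker φ.hom)).resolve_left hne
  have hs : Nontrivial N := (Submodule.nontrivial_iff_ne_bot).2 hN.1
  obtain ⟨k, hk, hT⟩ := exists_ext_ne_zero (ModuleCat.of Λ N) (hgd _) fun h =>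
    not_subsingleton N (ModuleCat.isZero_iff_subsingleton.1 h)
  obtain ⟨E', f, h1, h2, -, h3⟩ := hdom.exists_hom_ne_zero hid hk hT
  let ι : ModuleCat.of Λ N ⟶ M := ModuleCat.ofHom N.subtype
  have : Mono ι := (ModuleCat.mono_iff_injective ι).2 N.injective_subtype
  refine h3 ?_
  ext x
  have := hφ E' (Injective.factorThru f ι) ⟨h1, h2⟩ (hle x.2)
  rw [← Injective.comp_factorThru f ι]
  exact this

/-- Assuming enough finitely generated injectives: a finitely generated `M` with `id M ≤ k + 1`
and `Extᵏ⁺¹(E, M) = 0` for all finitely generated injectives `E` has `id M ≤ k`. -/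
lemma hasInjectiveDimensionLE_of_subsingleton_ext
    (hE : HasEnoughFiniteInjectives Λ)
    (k : ℕ) (M : ModuleCat.{v} Λ) [Module.Finite Λ M] (hM : HasInjectiveDimensionLE M (k + 1))
    (h : ∀ E : ModuleCat.{v} Λ, Module.Finite Λ E → Injective E →
      Subsingleton (Abelian.Ext E M (k + 1))) :
    HasInjectiveDimensionLE M k := by
  induction k generalizing M with
  | zero =>
    obtain ⟨E, f, _, hE', _⟩ := hE M
    have hS := shortExact_cokernel f
    have := injective_X₁_of_subsingleton_ext_one hS (h _ (finite_cokernel f)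
      (injective_iff_hasInjectiveDimensionLT_one.2
        ((hS.hasInjectiveDimensionLT_X₃_iff 0 hE').2 hM)))
    exact injective_iff_hasInjectiveDimensionLT_one.1 this
  | succ k ih =>
    obtain ⟨E, f, _, hE', _⟩ := hE M
    have hS := shortExact_cokernel f
    refine (hS.hasInjectiveDimensionLT_X₃_iff k hE').1 ?_
    refine ih (cokernel f) ((hS.hasInjectiveDimensionLT_X₃_iff (k + 1) hE').2 hM)
      fun X hX hX' => ?_
    exact subsingleton_ext_left_of_X₂_of_X₁ hS X
      (HasInjectiveDimensionLT.subsingleton _ 1 _ (by simp) _) (h X hX hX')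

end

/-! ### Indecomposable modules and Fitting's lemma -/

section Indecomposable

variable {Λ : Type v} [Ring Λ]

lemma eq_bot_or_eq_bot_of_isCompl {P : ModuleCat.{v} Λ} (hP : Indecomposable P)
    {p q : Submodule Λ P} (h : IsCompl p q) : p = ⊥ ∨ q = ⊥ := by
  let e : P ≅ ModuleCat.of Λ p ⊞ ModuleCat.of Λ q :=
    (Submodule.prodEquivOfIsCompl p q h).symm.toModuleIso (X₁ := P) ≪≫
      (ModuleCat.biprodIsoProd (ModuleCat.of Λ p) (ModuleCat.of Λ q)).symm
  refine (hP.2 _ _ e).imp (fun h => ?_) fun h => ?_ <;>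
  · rw [ModuleCat.isZero_iff_subsingleton] at h
    exact (Submodule.subsingleton_iff_eq_bot).1 h

/-- If a nonzero monomorphism `f : S ⟶ P` into an indecomposable module of finite length factors
as `S ⟶ E ⟶ P` with `E` injective, then `P` is injective. -/
lemma injective_of_extension {S P E : ModuleCat.{v} Λ} [IsArtinian Λ P] [IsNoetherian Λ P]
    (hP : Indecomposable P) [Injective E] (ι : S ⟶ E) (f : S ⟶ P) [Mono f] (hf : f ≠ 0)
    (g : E ⟶ P) (hg : ι ≫ g = f) : Injective P := by
  let h : P ⟶ E := Injective.factorThru ι f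
  have hh : f ≫ h = ι := Injective.comp_factorThru ι f
  let φ : Module.End Λ P := (h ≫ g).hom
  have hfix : ∀ x, φ (f.hom x) = f.hom x := fun x => by
    have : f ≫ h ≫ g = f := by rw [← Category.assoc, hh, hg]
    exact congr($(this).hom x)
  obtain ⟨k, hk⟩ := Filter.eventually_atTop.1 φ.eventually_isCompl_ker_pow_range_pow
  -- A positive exponent is needed for `ker φ` to lie in the kernel of the power.
  have hk' := hk (k + 1) (by simp)
  have hker : LinearMap.ker φ = ⊥ := by
    rcases eq_bot_or_eq_bot_of_isCompl hP hk' with h0 | h0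
    · rw [eq_bot_iff, ← h0, pow_succ]
      exact LinearMap.ker_le_ker_comp _ _
    -- The range of a power of `φ` contains the image of `f`, which `φ` fixes, so it cannot vanish.
    · refine absurd (ModuleCat.hom_ext (LinearMap.ext fun x => ?_)) hf
      have hpow : ∀ m : ℕ, (φ ^ m) (f.hom x) = f.hom x := by
        intro m
        induction m with
        | zero => rfl
        | succ m ih => rw [pow_succ, Module.End.mul_apply, hfix, ih]
      have : f.hom x ∈ LinearMap.range (φ ^ (k + 1)) := ⟨_, hpow _⟩
      rw [h0] at this
      exact this
  have hbij := IsArtinian.bijective_of_injective_endomorphism φ (LinearMap.ker_eq_bot.1 hker)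
  have : IsIso (h ≫ g) := (ConcreteCategory.isIso_iff_bijective (h ≫ g)).2 hbij
  exact Retract.injective (Y := E) ⟨h, g ≫ inv (h ≫ g), by rw [← Category.assoc]; simp⟩

lemma induction_indecomposable [IsArtinianRing Λ] {motive : ModuleCat.{v} Λ → Prop}
    (zero : ∀ M, IsZero M → motive M)
    (indecomposable : ∀ M : ModuleCat.{v} Λ, Module.Finite Λ M → Indecomposable M → motive M)
    (biprod : ∀ M Y Z : ModuleCat.{v} Λ, (M ≅ Y ⊞ Z) → motive Y → motive Z → motive M)
    (M : ModuleCat.{v} Λ) [Module.Finite Λ M] : motive M := by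
  induction hl : (Module.length Λ M).toNat using Nat.strong_induction_on generalizing M with
  | _ l ih =>
    by_cases hM : IsZero M
    · exact zero M hM
    by_cases hM' : Indecomposable M
    · exact indecomposable M ‹_› hM'
    simp only [Indecomposable, hM, not_false_eq_true, true_and, not_forall, not_or] at hM'
    obtain ⟨Y, Z, e, hY, hZ⟩ := hM'
    have : Module.Finite Λ (Y ⊞ Z : ModuleCat.{v} Λ) := finite_of_epi e.hom
    have hYf : Module.Finite Λ Y := finite_of_epi (Limits.biprod.fst : Y ⊞ Z ⟶ Y)
    have hZf : Module.Finite Λ Z := finite_of_epi (Limits.biprod.snd : Y ⊞ Z ⟶ Z)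
    rw [ModuleCat.isZero_iff_subsingleton, not_subsingleton_iff_nontrivial] at hY hZ
    have hlen : Module.length Λ M = Module.length Λ Y + Module.length Λ Z := by
      rw [(e ≪≫ ModuleCat.biprodIsoProd Y Z).toLinearEquiv.length_eq]
      exact Module.length_prod Λ Y Z
    have hYp := Module.length_pos (R := Λ) (M := Y)
    have hZp := Module.length_pos (R := Λ) (M := Z)
    obtain ⟨a, ha⟩ := ENat.ne_top_iff_exists.1 (Module.length_ne_top (R := Λ) (M := Y))
    obtain ⟨b, hb⟩ := ENat.ne_top_iff_exists.1 (Module.length_ne_top (R := Λ) (M := Z))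
    rw [← ha] at hYp
    rw [← hb] at hZp
    rw [hlen, ← ha, ← hb, ← Nat.cast_add, ENat.toNat_natCast] at hl
    norm_cast at hYp hZp
    exact biprod M Y Z e (ih a (by lia) Y (by rw [← ha]; rfl)) (ih b (by lia) Z (by rw [← hb]; rfl))

end Indecomposable

/-! ### Simple modules and maximal orthogonal subcategories -/

section

variable {Λ : Type v} [Ring Λ]

lemma mono_of_ne_zero {S M : ModuleCat.{v} Λ} [IsSimpleModule Λ S] (f : S ⟶ M) (hf : f ≠ 0) :
    Mono f :=
  (ModuleCat.mono_iff_injective f).2 ((LinearMap.injective_or_eq_zero f.hom).resolve_right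
    fun h => hf (ModuleCat.hom_ext h))

/-- For a projective `P` in the theorem this leaves only two cases: `P` is injective or `id P = m +
1`. -/
lemma injective_of_subsingleton_ext (hE : HasEnoughFiniteInjectives Λ) (k : ℕ)
    (M : ModuleCat.{v} Λ) [Module.Finite Λ M] (hM : HasInjectiveDimensionLE M k)
    (h : ∀ E : ModuleCat.{v} Λ, Module.Finite Λ E → Injective E →
      ∀ i, 1 ≤ i → i ≤ k → Subsingleton (Abelian.Ext E M i)) : Injective M := by
  induction k with
  | zero => exact injective_iff_hasInjectiveDimensionLT_one.2 hM
  | succ k ih =>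
    exact ih (hasInjectiveDimensionLE_of_subsingleton_ext hE k M hM
      fun E h1 h2 => h E h1 h2 _ (by simp) le_rfl) fun E h1 h2 i hi hi' => h E h1 h2 i hi (by lia)

/-- Dimension shifting along a finite injective coresolution of `M`. -/
lemma subsingleton_ext_of_hasInjectiveDimensionLE (hE : HasEnoughFiniteInjectives Λ) (k j : ℕ)
    (hj : 1 ≤ j) (M P : ModuleCat.{v} Λ) [Module.Finite Λ M] (hM : HasInjectiveDimensionLE M k)
    (h : ∀ E : ModuleCat.{v} Λ, Module.Finite Λ E → Injective E →
      ∀ i, 1 ≤ i → i ≤ j + k → Subsingleton (Abelian.Ext E P i)) :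
    Subsingleton (Abelian.Ext M P j) := by
  induction k generalizing M j with
  | zero => exact h M ‹_› (injective_iff_hasInjectiveDimensionLT_one.2 hM) j hj (by simp)
  | succ k ih =>
    obtain ⟨E, f, hE₁, hE₂, _⟩ := hE M
    have hS := shortExact_cokernel f
    exact subsingleton_ext_right_of_X₂_of_X₃ hS P (h E hE₁ hE₂ j hj (by lia))
      (ih (j + 1) (by lia) (cokernel f) ((hS.hasInjectiveDimensionLT_X₃_iff k hE₂).2 hM)
        fun E h1 h2 i hi hi' => h E h1 h2 i hi (by lia))

/-- A simple module of injective dimension at most `m` does not embed in an indecomposable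
non-injective module `P` with `Extⁱ(E, P) = 0` for finitely generated injectives `E` and
`1 ≤ i ≤ m`. -/
lemma eq_zero_of_hasInjectiveDimensionLE [IsArtinianRing Λ] (hE : HasEnoughFiniteInjectives Λ)
    {m : ℕ} (hm : 1 ≤ m) {S P : ModuleCat.{v} Λ} [IsSimpleModule Λ S] [Module.Finite Λ P]
    (hS : HasInjectiveDimensionLE S m) (hP : Indecomposable P) (hP' : ¬ Injective P)
    (h : ∀ E : ModuleCat.{v} Λ, Module.Finite Λ E → Injective E →
      ∀ i, 1 ≤ i → i ≤ m → Subsingleton (Abelian.Ext E P i)) (f : S ⟶ P) : f = 0 := by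
  obtain ⟨k, rfl⟩ := Nat.exists_eq_add_of_le' hm
  obtain ⟨E, ι, hE₁, hE₂, _⟩ := hE S
  have hses := shortExact_cokernel ι
  -- The cokernel of `ι` has `id ≤ m - 1`, so shifting from degree `1` only meets degrees up to `m`.
  refine eq_zero_of_no_extension hses P (fun g => ?_)
    (subsingleton_ext_of_hasInjectiveDimensionLE hE k 1 le_rfl _ P
      ((hses.hasInjectiveDimensionLT_X₃_iff k hE₂).2 hS)
      fun E h1 h2 i hi hi' => h E h1 h2 i hi (by lia)) f
  by_contra hne
  have := mono_of_ne_zero _ hne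
  exact hP' (injective_of_extension hP ι _ hne g rfl)

namespace IsMaximalOrthogonal

variable {m : ℕ} {𝒞 : ObjectProperty (ModuleCat.{v} Λ)}
  (h : IsMaximalOrthogonal m 𝒞 (finitelyGenerated Λ))

include h

lemma mem_iff_leftPerp (M : ModuleCat.{v} Λ) : 𝒞 M ↔ leftPerp m 𝒞 M :=
  (iff_of_eq (congrFun h.eq_leftPerp M)).trans ⟨And.left, fun H => ⟨H, H.1⟩⟩

lemma mem_iff_rightPerp (M : ModuleCat.{v} Λ) : 𝒞 M ↔ rightPerp m 𝒞 M :=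
  (iff_of_eq (congrFun h.eq_rightPerp M)).trans ⟨And.left, fun H => ⟨H, H.1⟩⟩

lemma finite {M : ModuleCat.{v} Λ} (hM : 𝒞 M) : Module.Finite Λ M :=
  h.le M hM

lemma mem_of_projective (M : ModuleCat.{v} Λ) [hM : Module.Finite Λ M] [Projective M] : 𝒞 M :=
  (h.mem_iff_leftPerp M).2
    ⟨hM, fun _ _ i hi _ => HasProjectiveDimensionLT.subsingleton _ 1 i hi _⟩

lemma mem_of_injective (M : ModuleCat.{v} Λ) [hM : Module.Finite Λ M] [Injective M] : 𝒞 M :=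
  (h.mem_iff_rightPerp M).2
    ⟨hM, fun _ _ i hi _ => HasInjectiveDimensionLT.subsingleton _ 1 i hi _⟩

lemma subsingleton_ext {X Y : ModuleCat.{v} Λ} (hX : 𝒞 X) (hY : 𝒞 Y) {i : ℕ} (hi : 1 ≤ i)
    (him : i ≤ m) : Subsingleton (Abelian.Ext X Y i) :=
  ((h.mem_iff_leftPerp X).1 hX).2 Y hY i hi him

/-- Every object of `𝒞` splits as a projective module and a module without nonzero morphisms to
projectives. -/
lemma exists_projective_quotient [IsArtinianRing Λ]
    (hdom : HasProjInjCoresolution (m + 1) (ModuleCat.of Λ Λ))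
    (hgd : ∀ M : ModuleCat.{v} Λ, HasProjectiveDimensionLE M (m + 1))
    {C : ModuleCat.{v} Λ} (hC : 𝒞 C) :
    ∃ (P : ModuleCat.{v} Λ) (π : C ⟶ P) (s : P ⟶ C), Module.Finite Λ P ∧ Projective P ∧
      s ≫ π = 𝟙 P ∧ ∀ Q : ModuleCat.{v} Λ, Module.Finite Λ Q → Projective Q →
        ∀ g : (kernel π : ModuleCat.{v} Λ) ⟶ Q, g = 0 := by
  have := h.finite hC
  obtain ⟨F, φ, ⟨hF, hF'⟩, hφ⟩ := exists_least_kernel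
    (fun E : ModuleCat.{v} Λ => Module.Finite Λ E ∧ Projective E)
    ⟨ModuleCat.of Λ Λ, inferInstance, inferInstance⟩
    (fun X Y ⟨_, _⟩ ⟨_, _⟩ => ⟨inferInstance, inferInstance⟩) C
  let π := Abelian.factorThruImage φ
  let ι := kernel.ι π
  -- A map `kernel π ⟶ Λ`, followed by `Λ ⟶ E` with `E` projective-injective, extends to `C`; that
  -- extension kills `ker φ = kernel π` by leastness.
  have hK : Subsingleton (Abelian.Ext (kernel π : ModuleCat.{v} Λ) (ModuleCat.of Λ Λ) 0) := by
    rw [subsingleton_ext_zero_iff]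
    intro g
    obtain ⟨_, E, Z, f, f', w, hS, hE, hE', hE'', -⟩ := hdom
    have : Mono f := hS.mono_f
    have hι : ι ≫ φ = 0 := by
      have : ι ≫ π ≫ Abelian.image.ι φ = 0 := by
        rw [← Category.assoc, kernel.condition, zero_comp]
      rwa [Abelian.image.fac] at this
    rw [← cancel_mono f, zero_comp, ← Injective.comp_factorThru (g ≫ f) ι]
    ext x
    exact hφ E _ ⟨hE, hE'⟩ (LinearMap.mem_ker.2 congr($(hι).hom x))
  have hK' : ∀ Q : ModuleCat.{v} Λ, Module.Finite Λ Q → Projective Q →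
      ∀ g : (kernel π : ModuleCat.{v} Λ) ⟶ Q, g = 0 := fun Q _ _ =>
    subsingleton_ext_zero_iff.1 (subsingleton_ext_projective hK Q)
  have hses := shortExact_kernel π
  have : Module.Finite Λ (Abelian.image φ : ModuleCat.{v} Λ) := finite_of_epi π
  -- As a submodule of a projective, the image has `pd ≤ m`. Its `Extⁱ` into `Λ` lies between
  -- `Extⁱ⁻¹(kernel π, Λ)` and `Extⁱ(C, Λ)`, both zero for `1 ≤ i ≤ m`.
  have hproj : Projective (Abelian.image φ) := by
    refine projective_of_subsingleton_ext m _ (((shortExact_cokernel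
      (Abelian.image.ι φ)).hasProjectiveDimensionLT_X₃_iff m hF').1 (hgd _)) fun i hi him => ?_
    obtain ⟨i, rfl⟩ := Nat.exists_eq_add_of_le' hi
    exact subsingleton_ext_right_of_X₁_of_X₂ hses _ (hdom.subsingleton_ext hK' (by lia))
      (h.subsingleton_ext hC (h.mem_of_projective _) hi him)
  exact ⟨_, π, Projective.factorThru (𝟙 _) π, this, hproj, by simp, hK'⟩

/-- If `S` is simple and does not embed in non-injective indecomposable projectives, then an
embedding of `S` in a projective-injective module is a left `𝒞`-approximation. -/
lemma exists_extension [IsArtinianRing Λ]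
    (hdom : HasProjInjCoresolution (m + 1) (ModuleCat.of Λ Λ))
    (hgd : ∀ M : ModuleCat.{v} Λ, HasProjectiveDimensionLE M (m + 1))
    {S Q : ModuleCat.{v} Λ} [IsSimpleModule Λ S] [Module.Finite Λ Q] [Projective Q] [Injective Q]
    (ι : S ⟶ Q) [Mono ι]
    (hS : ∀ P : ModuleCat.{v} Λ, Module.Finite Λ P → Projective P → Indecomposable P →
      ¬ Injective P → ∀ f : S ⟶ P, f = 0)
    {C : ModuleCat.{v} Λ} (hC : 𝒞 C) (f : S ⟶ C) : ∃ g : Q ⟶ C, ι ≫ g = f := by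
  have key : ∀ (P : ModuleCat.{v} Λ) [Module.Finite Λ P], Projective P →
      ∀ f : S ⟶ P, ∃ g : Q ⟶ P, ι ≫ g = f := by
    intro P _
    refine induction_indecomposable (motive := fun P => Projective P →
      ∀ f : S ⟶ P, ∃ g : Q ⟶ P, ι ≫ g = f) ?_ ?_ ?_ P
    · exact fun M hM _ f => ⟨0, hM.eq_of_tgt _ _⟩
    · intro M hM hM' hp f
      by_cases hi : Injective M
      · exact ⟨Injective.factorThru f ι, Injective.comp_factorThru f ι⟩
      · exact ⟨0, by rw [hS M hM hp hM' hi f, comp_zero]⟩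
    · intro M Y Z e hY hZ hM f
      have hYp : Projective Y := Retract.projective (Y := M)
        ⟨biprod.inl ≫ e.inv, e.hom ≫ biprod.fst, by simp⟩
      have hZp : Projective Z := Retract.projective (Y := M)
        ⟨biprod.inr ≫ e.inv, e.hom ≫ biprod.snd, by simp⟩
      obtain ⟨g₁, hg₁⟩ := hY hYp (f ≫ e.hom ≫ biprod.fst)
      obtain ⟨g₂, hg₂⟩ := hZ hZp (f ≫ e.hom ≫ biprod.snd)
      refine ⟨biprod.lift g₁ g₂ ≫ e.inv, ?_⟩
      rw [← Category.assoc, Iso.comp_inv_eq]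
      refine biprod.hom_ext _ _ ?_ ?_ <;> simp [hg₁, hg₂]
  obtain ⟨P, π, s, _, hP, hs, hK⟩ := h.exists_projective_quotient hdom hgd hC
  obtain ⟨g, hg⟩ := key P hP (f ≫ π)
  -- The component of `f` in `kernel π`. Were it nonzero it would be mono, and `ι` would factor
  -- through a map `kernel π ⟶ Q`, which is zero.
  let u : S ⟶ kernel π := kernel.lift π (f - f ≫ π ≫ s) (by simp [hs])
  have hu : u = 0 := by
    by_contra hne
    have := mono_of_ne_zero u hne
    have hι : ι = 0 := by
      rw [← Injective.comp_factorThru ι u, hK Q ‹_› ‹_› (Injective.factorThru ι u), comp_zero]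
    have : 𝟙 S = 0 := (cancel_mono ι).1 (by simp [hι])
    exact hne (by rw [← Category.id_comp u, this, zero_comp])
  have hfs : f - f ≫ π ≫ s = 0 := by
    rw [← kernel.lift_ι π (f - f ≫ π ≫ s) (by simp [hs])]
    exact (congrArg (· ≫ kernel.ι π) hu).trans zero_comp
  exact ⟨g ≫ s, by rw [← Category.assoc, hg, Category.assoc, (sub_eq_zero.1 hfs).symm]⟩

/-- Iterated left `𝒞`-approximations trade `Extⁱ(Z, 𝒞) = 0` for `1 ≤ i ≤ j` against
`Extᵈ(𝒞, Z) = 0` for `m + 1 - j ≤ d ≤ m`. -/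
lemma subsingleton_ext_of_forall (hE : HasEnoughFiniteInjectives Λ)
    {X : ModuleCat.{v} Λ} (hX : 𝒞 X) (j d : ℕ) (hjm : j ≤ m) (hdm : d ≤ m) (hjd : m + 1 ≤ j + d)
    (Z : ModuleCat.{v} Λ) [hZf : Module.Finite Λ Z]
    (hZ : ∀ C, 𝒞 C → ∀ i, 1 ≤ i → i ≤ j → Subsingleton (Abelian.Ext Z C i)) :
    Subsingleton (Abelian.Ext X Z d) := by
  obtain ⟨t, ht⟩ : ∃ t, j + t = m := ⟨m - j, by lia⟩
  induction t generalizing j d Z with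
  | zero =>
    obtain rfl : j = m := ht
    exact h.subsingleton_ext hX ((h.mem_iff_leftPerp Z).2 ⟨hZf, hZ⟩) (by lia) hdm
  | succ t ih =>
    obtain ⟨⟨C, f, hC, hf⟩, -⟩ := h.functoriallyFinite Z hZf
    have : Module.Finite Λ C := h.finite hC
    -- An embedding of `Z` in an injective, which lies in `𝒞`, factors through the approximation.
    have : Mono f := by
      obtain ⟨E, e, _, _, _⟩ := hE Z
      obtain ⟨g, rfl⟩ := hf E (h.mem_of_injective E) e
      exact mono_of_mono f g
    have hses := shortExact_cokernel f
    obtain ⟨d, rfl⟩ : ∃ d', d = d' + 1 := ⟨d - 1, by lia⟩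
    refine subsingleton_ext_left_of_X₃_of_X₂ hses X ?_ (h.subsingleton_ext hX hC (by simp) hdm)
    -- Passing to the cokernel raises `j` and lowers `d` by one, keeping `j + d ≥ m + 1`; at `j = m`
    -- the module lies in `𝒞`.
    refine ih (j + 1) d (by lia) (by lia) (by lia) (cokernel f) (fun C' hC' i hi hij => ?_)
      (by lia)
    obtain ⟨i, rfl⟩ := Nat.exists_eq_add_of_le' hi
    have hCC := h.subsingleton_ext hC hC' hi (by lia)
    cases i with
    | zero => exact subsingleton_ext_one_of_extension hses C' (hf C' hC') hCC
    | succ i =>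
      exact subsingleton_ext_right_of_X₁_of_X₂ hses C' (hZ C' hC' _ (by simp) (by lia)) hCC

end IsMaximalOrthogonal

lemma hasProjectiveDimensionLE_of_globalDimension_le {n : ℕ}
    (h : globalDimension Λ ≤ (n : WithBot ℕ∞)) (M : ModuleCat.{v} Λ) :
    HasProjectiveDimensionLE M n :=
  (projectiveDimension_le_iff M n).1 ((le_iSup (fun M => projectiveDimension M) M).trans h)

end

end HigherAuslander

end

/-! ### The theorem -/

theorem theorem3p8 {R : Type u} [CommRing R] [IsArtinianRing R]
    {Λ : Type v} [Ring Λ] [Algebra R Λ] [Module.Finite R Λ]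
    (n : ℕ) (hn : 2 ≤ n)
    (hΛ : HigherAuslander.IsAuslander Λ (n - 1))
    (hgd : HigherAuslander.globalDimension Λ = (n : WithBot ℕ∞))
    (𝒞 : ObjectProperty (ModuleCat.{v} Λ))
    (h𝒞 : HigherAuslander.IsMaximalOrthogonal (n - 1) 𝒞 (HigherAuslander.finitelyGenerated Λ))
    (S : ModuleCat.{v} Λ) [IsSimpleModule Λ S]
    (hS : projectiveDimension S = ((n - 1 : ℕ) : WithBot ℕ∞)) :
    ¬ Injective S ∧
    ((1 ≤ injectiveDimension S ∧ injectiveDimension S ≤ ((n - 1 : ℕ) : WithBot ℕ∞)) ↔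
      ∀ P : ModuleCat.{v} Λ, Module.Finite Λ P → Projective P → Indecomposable P →
        injectiveDimension P = (n : WithBot ℕ∞) → ∀ f : S ⟶ P, f = 0) ∧
    (injectiveDimension S = (n : WithBot ℕ∞) ↔
      ∃ P : ModuleCat.{v} Λ, Module.Finite Λ P ∧ Projective P ∧ Indecomposable P ∧
        injectiveDimension P = (n : WithBot ℕ∞) ∧ ∃ f : S ⟶ P, f ≠ 0) := by
  open HigherAuslander in
  have hart : IsArtinianRing Λ := isArtinian_of_tower R inferInstance
  obtain ⟨m, rfl⟩ : ∃ m, n = m + 1 := ⟨n - 1, by lia⟩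
  rw [Nat.add_sub_cancel] at *
  have hm : 1 ≤ m := by lia
  have hpd := hasProjectiveDimensionLE_of_globalDimension_le hgd.le
  have hid : ∀ M : ModuleCat.{v} Λ, HasInjectiveDimensionLE M (m + 1) := fun M =>
    hasInjectiveDimensionLT_of_enoughProjectives M _ fun Y =>
      (hpd Y).subsingleton _ _ _ le_rfl _
  have hdom := hΛ.hasProjInjCoresolution
  have hE : HasEnoughFiniteInjectives Λ := hasEnoughFiniteInjectives hdom hpd (hid _)
  have hS₀ : ¬ Limits.IsZero S := fun h =>
    not_subsingleton_iff_nontrivial.2 (IsSimpleModule.nontrivial Λ S)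
      (ModuleCat.isZero_iff_subsingleton.1 h)
  have hext : ¬ Subsingleton (Abelian.Ext S (ModuleCat.of Λ Λ) m) := fun h => by
    obtain ⟨k, rfl⟩ := Nat.exists_eq_add_of_le' hm
    have hk := hasProjectiveDimensionLE_of_subsingleton_ext k S
      ((projectiveDimension_le_iff S (k + 1)).1 hS.le) h
    exact (projectiveDimension_ge_iff S (k + 1)).1 hS.ge hk
  have hinj : ¬ Injective S := fun _ =>
    hext (h𝒞.subsingleton_ext (h𝒞.mem_of_injective S) (h𝒞.mem_of_projective _) hm le_rfl)
  have hProj : ∀ P : ModuleCat.{v} Λ, Module.Finite Λ P → Projective P →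
      ∀ E : ModuleCat.{v} Λ, Module.Finite Λ E → Injective E → ∀ i, 1 ≤ i → i ≤ m →
        Subsingleton (Abelian.Ext E P i) := fun P _ _ E _ _ i hi him =>
    h𝒞.subsingleton_ext (h𝒞.mem_of_injective E) (h𝒞.mem_of_projective P) hi him
  have hid_eq : ∀ M : ModuleCat.{v} Λ,
      injectiveDimension M = ((m + 1 : ℕ) : WithBot ℕ∞) ↔ ¬ HasInjectiveDimensionLE M m :=
    fun M => ⟨fun h => (injectiveDimension_ge_iff M (m + 1)).1 h.ge, fun h =>
      le_antisymm ((injectiveDimension_le_iff M _).2 (hid M))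
        ((injectiveDimension_ge_iff M (m + 1)).2 h)⟩
  have main : HasInjectiveDimensionLE S m ↔
      ∀ P : ModuleCat.{v} Λ, Module.Finite Λ P → Projective P → Indecomposable P →
        injectiveDimension P = ((m + 1 : ℕ) : WithBot ℕ∞) → ∀ f : S ⟶ P, f = 0 := by
    refine ⟨fun h P hP hP' hind hdim f => ?_, fun h => ?_⟩
    · exact eq_zero_of_hasInjectiveDimensionLE hE hm h hind
        (fun _ => (hid_eq P).1 hdim (hasInjectiveDimensionLT_of_ge P 1 _ (by simp)))
        (hProj P hP hP') f
    · obtain ⟨Q, ι, hQ, hQ', hQ'', hne⟩ := hdom.exists_hom_ne_zero (hid _) (by simp) hext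
      -- `Q` comes from degree `m < m + 1` of the coresolution of `Λ`, hence is projective as well
      -- as injective.
      have := hQ'' (by simp)
      have := mono_of_ne_zero ι hne
      have hses := shortExact_cokernel ι
      have hZ : ∀ C, 𝒞 C → ∀ i, 1 ≤ i → i ≤ 1 →
          Subsingleton (Abelian.Ext (Limits.cokernel ι) C i) := fun C hC i hi hi' => by
        obtain rfl : i = 1 := by lia
        refine subsingleton_ext_one_of_extension hses C
          (h𝒞.exists_extension hdom hpd ι (fun P hP hP' hind hni => ?_) hC)
          (HasProjectiveDimensionLT.subsingleton _ 1 _ le_rfl _)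
        exact h P hP hP' hind ((hid_eq P).2 fun hle =>
          hni (injective_of_subsingleton_ext hE m P hle (hProj P hP hP')))
      -- `Extᵐ⁺¹(X, S)` is squeezed between `Extᵐ(X, Q/S)` and `Extᵐ⁺¹(X, Q)`; the first vanishes by
      -- the case `j = 1`, `d = m` of the approximation argument.
      refine hasInjectiveDimensionLE_of_subsingleton_ext hE m S (hid S) fun X _ _ => ?_
      exact subsingleton_ext_left_of_X₃_of_X₂ hses X
        (h𝒞.subsingleton_ext_of_forall hE (h𝒞.mem_of_injective X) 1 m hm le_rfl (by lia) _ hZ)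
        (HasInjectiveDimensionLT.subsingleton _ 1 _ (by simp) _)
  refine ⟨hinj, ?_, ?_⟩
  · rw [← main, injectiveDimension_le_iff]
    refine and_iff_right ?_
    have := (injectiveDimension_ge_iff S 1).2 fun h =>
      hinj (injective_iff_hasInjectiveDimensionLT_one.2 h)
    exact_mod_cast this
  · rw [hid_eq, main]
    push Not
    rfl
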